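/- Monoids are commutative and written additively. Let $I$ be a nonempty lower semilattice (a partially ordered set in which any two elements have an infimum), and let $\mathbb{M}=((M_i)_{i\in I},(p_{ij}\colon M_j\to M_i)_{i\le j})$ be a projective system of monoids over $I$ that is openly immersive, i.e. for all $i\le j$ the morphism $\operatorname{Spec}(\mathbb{Z}[p_{ij}])\colon\operatorname{Spec}(\mathbb{Z}[M_i])\to\operatorname{Spec}(\mathbb{Z}[M_j])$ is an open immersion. Suppose that $\mathbb{M}$ is cancellable, i.e. for every $i\in I$ and all $m,k,l\in M_i$, $m+k=m+l$ implies $k=l$. Let $X_{\mathbb{M}}(\mathbb{Z})$ be the inductive limit in the category of schemes of the system $(\operatorname{Spec}(\mathbb{Z}[M_i]))_{i\in I}$, which exists, and for a scheme $S$ set $X_{\mathbb{M}}(S):=X_{\mathbb{M}}(\mathbb{Z})\times S$. Let $r:=\sup_{i\in I}\operatorname{rk}(\operatorname{diff}(M_i))$, where $\operatorname{diff}(M_i)$ is the group of differences of $M_i$ and $\operatorname{rk}(G):=\dim_{\mathbb{Q}}(G\otimes_{\mathbb{Z}}\mathbb{Q})$ for an abelian group $G$, and suppose that $r$ is finite.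 Then for every scheme $S$, $$\dim(S)+r\le\dim(X_{\mathbb{M}}(S))\le(r+1)\dim(S)+r,$$ and if $S$ is moreover locally noetherian, then $$\dim(X_{\mathbb{M}}(S))=\dim(S)+r.$$ Here $\dim$ is the Krull dimension of the underlying topological space, with values in $\mathbb{N}\cup\{\pm\infty\}$, and $\dim(\emptyset)=-\infty$. -/

import Mathlib

universe u

open CategoryTheory CategoryTheory.Limits AlgebraicGeometry Opposite

noncomputable section

namespace ToricScheme

section Gluing

/- Existence of the inductive limit of a system of separated schemes with scheme-theoretically dense
open immersions over a lower semilattice, and openness of its canonical morphisms. The pieces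
`F i`, `F j` may meet in more than `F (i ⊓ j)`, so the system is enlarged to all open subschemes of
the `F i` before the limit is taken; this does not change the limit. -/

lemma hom_ext_of_schemeTheoreticallyDominant {T X Y : Scheme.{u}} (d : T ⟶ X)
    [IsSchemeTheoreticallyDominant d] [Y.IsSeparated] {f g : X ⟶ Y} (h : d ≫ f = d ≫ g) :
    f = g := by
  have hk : (equalizer.ι f g).ker = ⊥ := by
    rw [eq_bot_iff, ← d.ker_eq_bot, ← equalizer.lift_ι d h]
    exact Scheme.Hom.le_ker_comp _ _
  have := IsClosedImmersion.isIso_iff_ker_eq_bot.mpr hk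
  rw [← cancel_epi (equalizer.ι f g), equalizer.condition]

variable {I : Type u} [SemilatticeInf I] (F : I ⥤ Scheme.{u})

/-- `g` is a gluing map from the open subscheme `W` of `F i` to `F j`: it is an open immersion,
it is respected by every cocone, and it is the identity on some common piece `F k`. -/
structure IsGlueMap {i j : I} {W : (F.obj i).Opens} (g : W.toScheme ⟶ F.obj j) : Prop where
  isOpenImmersion : IsOpenImmersion g
  cocone : ∀ c : Cocone F, W.ι ≫ c.ι.app i = g ≫ c.ι.app j
  compat : ∃ (k : I) (hi : k ≤ i) (hj : k ≤ j), ∀ (T : Scheme.{u}) (a : T ⟶ F.obj k)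
    (b : T ⟶ W.toScheme) [IsOpenImmersion b],
    a ≫ F.map (homOfLE hi) = b ≫ W.ι → a ≫ F.map (homOfLE hj) = b ≫ g

/-- The conditions on an inductive system of schemes over a lower semilattice under which
it can be glued. -/
class Glueable : Prop where
  isOpenImmersion {i j : I} (f : i ⟶ j) : IsOpenImmersion (F.map f)
  quasiCompact {i j : I} (f : i ⟶ j) : QuasiCompact (F.map f)
  dominant {i j : I} (f : i ⟶ j) : IsSchemeTheoreticallyDominant (F.map f)
  isSeparated (i : I) : (F.obj i).IsSeparated

attribute [instance] Glueable.isOpenImmersion Glueable.quasiCompact Glueable.dominant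
  Glueable.isSeparated

variable {F}

lemma IsGlueMap.of_map {i j : I} (hij : i ≤ j) (W : (F.obj i).Opens)
    [∀ {i j : I} (f : i ⟶ j), IsOpenImmersion (F.map f)] :
    IsGlueMap F (W.ι ≫ F.map (homOfLE hij)) where
  isOpenImmersion := inferInstance
  cocone c := by simp
  compat := ⟨i, le_rfl, hij, fun T a b _ h ↦ by
    rw [← reassoc_of% h, ← F.map_comp]; rfl⟩

lemma IsGlueMap.unique [Glueable F] {i j : I} {W : (F.obj i).Opens} {g g' : W.toScheme ⟶ F.obj j}
    (hg : IsGlueMap F g) (hg' : IsGlueMap F g') : g = g' := by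
  obtain ⟨k, hi, hj, h⟩ := hg.compat
  obtain ⟨k', hi', hj', h'⟩ := hg'.compat
  have hl : k ⊓ k' ≤ i := inf_le_left.trans hi
  have key := pullback.condition (f := F.map (homOfLE hl)) (g := W.ι)
  apply hom_ext_of_schemeTheoreticallyDominant (pullback.snd (F.map (homOfLE hl)) W.ι)
  rw [← h _ (pullback.fst _ _ ≫ F.map (homOfLE inf_le_left)) _
      (by rw [← key, Category.assoc, ← F.map_comp]; rfl),
    ← h' _ (pullback.fst _ _ ≫ F.map (homOfLE inf_le_right)) _
      (by rw [← key, Category.assoc, ← F.map_comp]; rfl)]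
  simp only [Category.assoc, ← F.map_comp]
  rfl

lemma IsGlueMap.comp {i j k : I} {W : (F.obj i).Opens} {V : (F.obj j).Opens}
    {f : W.toScheme ⟶ V.toScheme} {g : V.toScheme ⟶ F.obj k}
    (hf : IsGlueMap F (f ≫ V.ι)) (hg : IsGlueMap F g) : IsGlueMap F (f ≫ g) := by
  have := hg.isOpenImmersion
  have := hf.isOpenImmersion
  have hfo : IsOpenImmersion f := IsOpenImmersion.of_comp f V.ι
  obtain ⟨l, hi, hj, h⟩ := hf.compat
  obtain ⟨l', hi', hj', h'⟩ := hg.compat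
  refine ⟨inferInstance, fun c ↦ ?_, l ⊓ l', inf_le_left.trans hi, inf_le_right.trans hj', ?_⟩
  · rw [Category.assoc, ← hg.cocone, hf.cocone, Category.assoc]
  · intro T a b _ hab
    have h1 := h T (a ≫ F.map (homOfLE inf_le_left)) b
      (by rw [← hab, Category.assoc, ← F.map_comp]; rfl)
    have h2 := h' T (a ≫ F.map (homOfLE inf_le_right)) (b ≫ f) (by
      rw [Category.assoc, Category.assoc, ← h1, Category.assoc, ← F.map_comp, ← F.map_comp]; rfl)
    rw [Category.assoc, Category.assoc, ← F.map_comp] at h2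
    rw [← h2]; rfl

/-- Two points identified in `F k` by gluing maps are already identified by a gluing map. -/
lemma IsGlueMap.cancel [Glueable F] {i j k : I} {W : (F.obj i).Opens} {V : (F.obj j).Opens}
    {f : W.toScheme ⟶ F.obj k} {g : V.toScheme ⟶ F.obj k} (hf : IsGlueMap F f)
    (hg : IsGlueMap F g) (h : W.toScheme ⟶ V.toScheme) (w : h ≫ g = f) :
    IsGlueMap F (h ≫ V.ι) := by
  have := hg.isOpenImmersion
  have := hf.isOpenImmersion
  have : IsOpenImmersion (h ≫ g) := by rwa [w]
  have hh : IsOpenImmersion h := IsOpenImmersion.of_comp h g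
  refine ⟨inferInstance, fun c ↦ ?_, ?_⟩
  · rw [Category.assoc, hg.cocone, hf.cocone, ← w, Category.assoc]
  obtain ⟨m, mi, mk, hm⟩ := hf.compat
  obtain ⟨n, nj, nk, hn⟩ := hg.compat
  have lj : m ⊓ n ≤ j := inf_le_right.trans nj
  refine ⟨m ⊓ n, inf_le_left.trans mi, lj, fun T a b _ hab ↦ ?_⟩
  let t : T ⟶ F.obj j := b ≫ h ≫ V.ι
  let e : F.obj (m ⊓ n) ⟶ F.obj j := F.map (homOfLE lj)
  have hc : pullback.fst t e ≫ t = pullback.snd t e ≫ e := pullback.condition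
  have h1 := hn _ (pullback.snd t e ≫ F.map (homOfLE inf_le_right)) (pullback.fst t e ≫ b ≫ h)
    (by
      rw [Category.assoc, ← F.map_comp]
      simp only [Category.assoc]
      exact hc.symm)
  have h2 := hm _ (a ≫ F.map (homOfLE inf_le_left)) b
    (by rw [← hab, Category.assoc, ← F.map_comp]; rfl)
  have h3 : pullback.snd t e = pullback.fst t e ≫ a := by
    rw [← cancel_mono (F.map (homOfLE (inf_le_left.trans mk : m ⊓ n ≤ k)))]
    simp only [Category.assoc, w, ← F.map_comp] at h1 h2
    rw [Category.assoc]
    refine h1.trans ?_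
    rw [← h2]; rfl
  apply hom_ext_of_schemeTheoreticallyDominant (pullback.fst t e)
  rw [← reassoc_of% h3]
  exact hc.symm

variable (F)

/-- The poset of open subschemes of the members of the system, ordered by gluing maps. -/
structure Piece where
  idx : I
  opn : (F.obj idx).Opens

variable [Glueable F]

instance : Preorder (Piece F) where
  le a b := ∃ f : a.opn.toScheme ⟶ b.opn.toScheme, IsGlueMap F (f ≫ b.opn.ι)
  le_refl a := ⟨𝟙 _, by simpa using IsGlueMap.of_map (F := F) (le_refl a.idx) a.opn⟩
  le_trans a b c := by
    rintro ⟨f, hf⟩ ⟨g, hg⟩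
    exact ⟨f ≫ g, by simpa using hf.comp hg⟩

variable {F} in
/-- The gluing map between comparable pieces. -/
def Piece.map {a b : Piece F} (h : a ≤ b) : a.opn.toScheme ⟶ b.opn.toScheme := h.choose

lemma Piece.isGlueMap {a b : Piece F} (h : a ≤ b) : IsGlueMap F (Piece.map h ≫ b.opn.ι) :=
  h.choose_spec

lemma Piece.map_eq {a b : Piece F} (h : a ≤ b) (f : a.opn.toScheme ⟶ b.opn.toScheme)
    (hf : IsGlueMap F (f ≫ b.opn.ι)) : Piece.map h = f := by
  rw [← cancel_mono b.opn.ι]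
  exact (Piece.isGlueMap F h).unique hf

/-- The system of all pieces. -/
def pieces : Piece F ⥤ Scheme.{u} where
  obj a := a.opn.toScheme
  map f := Piece.map (leOfHom f)
  map_id a := Piece.map_eq F _ _
    (by simpa using IsGlueMap.of_map (F := F) (le_refl a.idx) a.opn)
  map_comp f g := Piece.map_eq F _ _ (by
    rw [Category.assoc]
    exact (Piece.isGlueMap F (leOfHom f)).comp (Piece.isGlueMap F (leOfHom g)))

instance {a b : Piece F} (f : a ⟶ b) : IsOpenImmersion ((pieces F).map f) := by
  have := (Piece.isGlueMap F (leOfHom f)).isOpenImmersion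
  exact IsOpenImmersion.of_comp (Piece.map (leOfHom f)) b.opn.ι

instance : Small.{u} (Piece F) :=
  small_of_injective (β := Σ i, (F.obj i).Opens) (f := fun a ↦ ⟨a.idx, a.opn⟩) (by
    rintro ⟨i, W⟩ ⟨j, V⟩ h
    cases h; rfl)

instance : (pieces F ⋙ Scheme.forget).IsLocallyDirected where
  cond {a b c} fa fb x y hxy := by
    let f : a.opn.toScheme ⟶ c.opn.toScheme := Piece.map (leOfHom fa)
    let g : b.opn.toScheme ⟶ c.opn.toScheme := Piece.map (leOfHom fb)
    have hgo : IsOpenImmersion g := inferInstanceAs (IsOpenImmersion ((pieces F).map fb))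
    have hfo : IsOpenImmersion f := inferInstanceAs (IsOpenImmersion ((pieces F).map fa))
    replace hxy : f x = g y := hxy
    let U : a.opn.toScheme.Opens := f ⁻¹ᵁ g.opensRange
    let d : Piece F := ⟨a.idx, a.opn.ι ''ᵁ U⟩
    let e : d.opn.toScheme ⟶ a.opn.toScheme := (a.opn.ι.isoImage U).inv ≫ U.ι
    have he : e ≫ a.opn.ι = d.opn.ι := by simp [e, d]
    have hgl : IsGlueMap F (e ≫ a.opn.ι) := by
      rw [he]
      simpa using IsGlueMap.of_map (F := F) (le_refl a.idx) d.opn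
    have hr : Set.range (e ≫ f) ⊆ Set.range g := by
      rintro _ ⟨z, rfl⟩
      exact ((a.opn.ι.isoImage U).inv z).2
    let h : d.opn.toScheme ⟶ b.opn.toScheme := IsOpenImmersion.lift g (e ≫ f) hr
    have hh : h ≫ g = e ≫ f := IsOpenImmersion.lift_fac _ _ _
    have hcomp : IsGlueMap F ((e ≫ f) ≫ c.opn.ι) := by
      rw [Category.assoc]
      exact hgl.comp (Piece.isGlueMap F (leOfHom fa))
    have hgl' : IsGlueMap F (h ≫ b.opn.ι) :=
      hcomp.cancel (Piece.isGlueMap F (leOfHom fb)) h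
        (by rw [← hh, Category.assoc])
    have hda : d ≤ a := ⟨e, hgl⟩
    have hdb : d ≤ b := ⟨h, hgl'⟩
    have hxU : x ∈ U := ⟨y, hxy.symm⟩
    let z : d.opn.toScheme := (a.opn.ι.isoImage U).hom ⟨x, hxU⟩
    have hz : e z = x := by
      change ((a.opn.ι.isoImage U).inv ≫ U.ι) ((a.opn.ι.isoImage U).hom ⟨x, hxU⟩) = x
      refine (Scheme.Hom.comp_apply _ _ _).symm.trans ?_
      rw [Iso.hom_inv_id_assoc]
      rfl
    refine ⟨d, homOfLE hda, homOfLE hdb, z, ?_, ?_⟩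
    · change Piece.map hda z = x
      rw [Piece.map_eq F hda e hgl, hz]
    · change Piece.map hdb z = y
      rw [Piece.map_eq F hdb h hgl']
      apply g.isOpenEmbedding.injective
      rw [← hxy, ← hz, ← Scheme.Hom.comp_apply, hh, Scheme.Hom.comp_apply]

variable {F} in
/-- The whole of `F i` as a piece. -/
def Piece.whole (i : I) : Piece F := ⟨i, ⊤⟩

lemma Piece.le_whole {a : Piece F} {j : I} (h : a.idx ≤ j) : a ≤ Piece.whole j :=
  ⟨a.opn.ι ≫ F.map (homOfLE h) ≫ (F.obj j).topIso.inv, by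
    simpa [Piece.whole] using IsGlueMap.of_map (F := F) h a.opn⟩

lemma Piece.map_le_whole {a : Piece F} {j : I} (h : a.idx ≤ j) :
    Piece.map (Piece.le_whole F h) = a.opn.ι ≫ F.map (homOfLE h) ≫ (F.obj j).topIso.inv :=
  Piece.map_eq F _ _ (by simpa [Piece.whole] using IsGlueMap.of_map (F := F) h a.opn)

variable {F} in
/-- The inclusion of a piece. -/
def Piece.incl (a : Piece F) : (pieces F).obj a ⟶ F.obj a.idx := a.opn.ι

/-- The identification of `F i` with its whole piece. -/
def toWhole (i : I) : F.obj i ⟶ (pieces F).obj (Piece.whole i) := (F.obj i).topIso.inv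

instance (i : I) : IsOpenImmersion (toWhole F i) :=
  inferInstanceAs (IsOpenImmersion (F.obj i).topIso.inv)

lemma toWhole_incl (i : I) : toWhole F i ≫ (Piece.whole i).incl = 𝟙 _ :=
  (F.obj i).topIso.inv_hom_id

lemma pieces_map_whole {a : Piece F} {j : I} (h : a.idx ≤ j) :
    (pieces F).map (homOfLE (Piece.le_whole F h)) =
      a.incl ≫ F.map (homOfLE h) ≫ toWhole F j :=
  Piece.map_le_whole F h

lemma incl_cocone (c : Cocone F) {a b : Piece F} (f : a ⟶ b) :
    (pieces F).map f ≫ b.incl ≫ c.ι.app b.idx = a.incl ≫ c.ι.app a.idx := by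
  rw [← Category.assoc]
  exact ((Piece.isGlueMap F (leOfHom f)).cocone c).symm

/-- The cocone of open immersions which glues the system. -/
def glueCocone : Cocone F where
  pt := colimit (pieces F)
  ι :=
    { app i := toWhole F i ≫ colimit.ι (pieces F) (Piece.whole i)
      naturality i j f := by
        have h := colimit.w (pieces F) (homOfLE (Piece.le_whole F (a := Piece.whole i) (leOfHom f)))
        rw [pieces_map_whole F (a := Piece.whole i) (leOfHom f)] at h
        simp only [Functor.const_obj_obj, Functor.const_obj_map, Category.comp_id]
        rw [← h, Category.assoc, Category.assoc]
        exact ((reassoc_of% (toWhole_incl F i))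
          (F.map f ≫ toWhole F j ≫ colimit.ι (pieces F) (Piece.whole j))).symm }

instance (i : I) : IsOpenImmersion ((glueCocone F).ι.app i) :=
  inferInstanceAs (IsOpenImmersion (toWhole F i ≫ colimit.ι (pieces F) (Piece.whole i)))

/-- The gluing is an inductive limit. -/
def glueCoconeIsColimit : IsColimit (glueCocone F) where
  desc c := colimit.desc (pieces F)
    { pt := c.pt
      ι :=
        { app a := a.incl ≫ c.ι.app a.idx
          naturality a b f := by
            simp only [Functor.const_obj_obj, Functor.const_obj_map, Category.comp_id]
            exact incl_cocone F c f } }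
  fac c i := by
    change (toWhole F i ≫ colimit.ι (pieces F) (Piece.whole i)) ≫ _ = _
    rw [Category.assoc, colimit.ι_desc]
    exact (reassoc_of% (toWhole_incl F i)) (c.ι.app i)
  uniq c m hm := by
    refine colimit.hom_ext (F := pieces F) fun a ↦ ?_
    rw [colimit.ι_desc, ← colimit.w (pieces F) (homOfLE (Piece.le_whole F (le_refl a.idx))),
      pieces_map_whole F (le_refl a.idx)]
    have : F.map (homOfLE (le_refl a.idx)) = 𝟙 _ := F.map_id _
    rw [this, Category.id_comp, Category.assoc]
    refine (Category.assoc _ _ _).trans ?_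
    exact congrArg (fun t ↦ a.incl ≫ t) ((Category.assoc _ _ _).symm.trans (hm a.idx))

instance hasColimit_of_glueable : HasColimit F := ⟨_, glueCoconeIsColimit F⟩

end Gluing

section Monoids

open AddMonoidAlgebra

/-- The functor `M ↦ ℤ[M]` from commutative monoids to commutative rings. -/
def monoidRing : AddCommMonCat.{u} ⥤ CommRingCat.{u} where
  obj M := CommRingCat.of (AddMonoidAlgebra ℤ M)
  map f := CommRingCat.ofHom (mapDomainRingHom ℤ f.hom)
  map_id M := by
    rw [AddCommMonCat.hom_id, mapDomainRingHom_id]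
    rfl
  map_comp f g := by
    rw [AddCommMonCat.hom_comp, mapDomainRingHom_comp]
    rfl

/-- The augmentation (sum of the coefficients) of a monoid ring. -/
def augmentation (M : Type*) [AddMonoid M] : AddMonoidAlgebra ℤ M →+* ℤ :=
  (AddMonoidAlgebra.lift ℤ ℤ M 1).toRingHom

lemma augmentation_mapDomain {M N : Type*} [AddMonoid M] [AddMonoid N] (p : M →+ N)
    (b : AddMonoidAlgebra ℤ M) : augmentation N (mapDomainRingHom ℤ p b) = augmentation M b := by
  suffices (augmentation N).comp (mapDomainRingHom ℤ p) = augmentation M from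
    RingHom.congr_fun this b
  apply AddMonoidAlgebra.ringHom_ext <;> intro x <;> simp [augmentation]

/-- The derivation of a monoid ring along an additive map `c`. -/
def derivAlong {M A : Type*} [AddMonoid M] [AddCommGroup A] (c : M →+ A) :
    AddMonoidAlgebra ℤ M →+ A :=
  (Finsupp.liftAddHom fun x ↦ (AddMonoidHom.flip (smulAddHom ℤ A)) (c x)).comp
    (coeffAddEquiv (R := ℤ) (M := M)).toAddMonoidHom

lemma derivAlong_single {M A : Type*} [AddMonoid M] [AddCommGroup A] (c : M →+ A) (x : M) (k : ℤ) :
    derivAlong c (single x k) = k • c x := by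
  change (Finsupp.single x k).sum (fun x r ↦ r • c x) = _
  exact Finsupp.sum_single_index (zero_smul _ _)

lemma derivAlong_mul_single {M A : Type*} [AddMonoid M] [AddCommGroup A] (c : M →+ A)
    (b : AddMonoidAlgebra ℤ M) (m : M) :
    derivAlong c (b * single m 1) = derivAlong c b + augmentation M b • c m := by
  induction b using AddMonoidAlgebra.induction_linear with
  | zero => simp
  | add f g hf hg => simp only [add_mul, map_add, hf, hg, add_smul]; abel
  | single x k =>
    rw [single_mul_single, derivAlong_single, derivAlong_single]
    simp [augmentation]

/-- Distinct elements of a cancellable monoid are separated by characters. -/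
lemma exists_character_ne {M : Type*} [AddCommMonoid M] [IsCancelAdd M] {m n : M} (hne : m ≠ n) :
    ∃ d : M →+ AddCircle (1 : ℚ), d m - d n ≠ 0 := by
  let i : M →+ Algebra.GrothendieckAddGroup M := (AddLocalization.addMonoidOf ⊤).toAddMonoidHom
  have hi : i m - i n ≠ 0 := fun h ↦
    hne (AddLocalization.mk_left_injective (s := ⊤) 0 (sub_eq_zero.mp h))
  obtain ⟨c, hc⟩ := CharacterModule.exists_character_apply_ne_zero_of_ne_zero hi
  refine ⟨(AddMonoidHomClass.toAddMonoidHom c).comp i, fun h ↦ hc ?_⟩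
  rw [map_sub]
  exact h

/-- If `x` dies in a flat algebra, then the annihilator of `x` generates the unit ideal there. -/
lemma flat_relation_algebra {A B : Type*} [CommRing A] [CommRing B] [Algebra A B] [Module.Flat A B] (x : A)
    (hx : algebraMap A B x = 0) : ∃ (k : ℕ) (a : Fin k → A) (y : Fin k → B),
      1 = ∑ j, algebraMap A B (a j) * y j ∧ ∀ j, x * a j = 0 := by
  have h0 : ∑ j : Fin 1, (![x] j) • ((fun _ ↦ 1 : Fin 1 → B) j) = 0 := by
    simp [Algebra.smul_def, hx]
  obtain ⟨k, a, y, h1, h2⟩ := (Module.Flat.iff_forall_isTrivialRelation (R := A) (M := B)).mp inferInstance h0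
  refine ⟨k, a 0, y, ?_, fun j ↦ ?_⟩
  · have := h1 0
    simp only [Algebra.smul_def] at this
    exact this
  · have := h2 j
    simpa using this

lemma flat_relation {A B : Type*} [CommRing A] [CommRing B] (f : A →+* B) (hf : f.Flat) (x : A)
    (hx : f x = 0) : ∃ (k : ℕ) (a : Fin k → A) (y : Fin k → B),
      1 = ∑ j, f (a j) * y j ∧ ∀ j, x * a j = 0 := by
  let _ : Algebra A B := f.toAlgebra
  have _ : Module.Flat A B := hf
  exact flat_relation_algebra (A := A) (B := B) x hx

/-- A morphism of monoids that is flat after passing to monoid rings and whose source is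
cancellable is injective. -/
lemma injective_of_flat {M N : Type*} [AddCommMonoid M] [IsCancelAdd M] [AddCommMonoid N]
    (p : M →+ N) (hp : (mapDomainRingHom ℤ p).Flat) : Function.Injective p := by
  intro m n hmn
  by_contra hne
  obtain ⟨d, hd⟩ := exists_character_ne hne
  have key (b : AddMonoidAlgebra ℤ M) (hb : (single m 1 - single n 1) * b = 0) :
      augmentation M b • (d m - d n) = 0 := by
    rw [mul_comm, mul_sub, sub_eq_zero] at hb
    have := congrArg (derivAlong d) hb
    rw [derivAlong_mul_single, derivAlong_mul_single] at this
    rw [smul_sub, sub_eq_zero]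
    exact add_left_cancel this
  obtain ⟨k, a, y, h1, h2⟩ := flat_relation (mapDomainRingHom ℤ p) hp
    (single m 1 - single n 1) (by
      rw [map_sub, mapDomainRingHom_apply, mapDomainRingHom_apply, mapDomain_single,
        mapDomain_single, hmn, sub_self])
  have h3 := congrArg (augmentation N) h1
  rw [map_one, map_sum] at h3
  simp only [map_mul, augmentation_mapDomain] at h3
  apply hd
  rw [← one_smul ℤ (d m - d n), h3, Finset.sum_smul]
  refine Finset.sum_eq_zero fun j _ ↦ ?_
  rw [mul_comm, mul_smul, key _ (h2 j), smul_zero]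

end Monoids

section System

variable {I : Type u} [SemilatticeInf I] (𝕄 : Iᵒᵖ ⥤ AddCommMonCat.{u})

/-- The inductive system of the affine schemes `Spec ℤ[M i]`. -/
def charts : I ⥤ Scheme.{u} := 𝕄.rightOp ⋙ monoidRing.op ⋙ Scheme.Spec

/-- A projective system of commutative monoids is openly immersive if the morphisms
`Spec ℤ[M i] ⟶ Spec ℤ[M j]`, `i ≤ j`, are open immersions. -/
class OpenlyImmersive : Prop where
  isOpenImmersion {i j : I} (f : i ⟶ j) : IsOpenImmersion ((charts 𝕄).map f)

/-- A projective system of commutative monoids is cancellable if its members are. -/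
class Cancellable : Prop where
  isCancelAdd (i : I) : IsCancelAdd (𝕄.obj (op i))

instance [OpenlyImmersive 𝕄] [Cancellable 𝕄] : Glueable (charts 𝕄) where
  isOpenImmersion := OpenlyImmersive.isOpenImmersion
  quasiCompact {i j} f :=
    inferInstanceAs (QuasiCompact (Spec.map (monoidRing.map (𝕄.map f.op))))
  isSeparated i :=
    inferInstanceAs (Spec (monoidRing.obj (𝕄.obj (op i)))).IsSeparated
  dominant {i j} f := by
    have h : IsOpenImmersion (Spec.map (monoidRing.map (𝕄.map f.op))) :=
      OpenlyImmersive.isOpenImmersion (𝕄 := 𝕄) f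
    have := Cancellable.isCancelAdd (𝕄 := 𝕄) j
    have hf : Flat (Spec.map (monoidRing.map (𝕄.map f.op))) := inferInstance
    have hinj := AddMonoidAlgebra.mapDomain_injective (R := ℤ)
      (injective_of_flat _ (Flat.SpecMap_iff.mp hf))
    change IsSchemeTheoreticallyDominant (Spec.map (monoidRing.map (𝕄.map f.op)))
    rw [isSchemeTheoreticallyDominant_iff]
    refine Scheme.IdealSheafData.ext_of_isAffine ?_
    have hi : Function.Injective (Spec.map (monoidRing.map (𝕄.map f.op))).appTop := by
      rw [← ConcreteCategory.mono_iff_injective_of_preservesPullback]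
      have hm : Mono (monoidRing.map (𝕄.map f.op)) :=
        ConcreteCategory.mono_of_injective _ hinj
      rw [← mono_comp_iff_of_mono _ (Scheme.ΓSpecIso _).hom, Scheme.ΓSpecIso_naturality]
      infer_instance
    rw [Scheme.Hom.ker_apply]
    exact (RingHom.injective_iff_ker_eq_bot _).mp hi

/-- The scheme `X_𝕄(ℤ)`, the inductive limit of the schemes `Spec ℤ[M i]`. For openly immersive
cancellable systems it exists by the instance above. -/
def toricSchemeInt [HasColimit (charts 𝕄)] : Scheme.{u} := colimit (charts 𝕄)

/-- The scheme `X_𝕄(S)`, the product of `X_𝕄(ℤ)` and `S` over the terminal scheme. -/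
def toricScheme [HasColimit (charts 𝕄)] (S : Scheme.{u}) : Scheme.{u} :=
  pullback (terminal.from (toricSchemeInt 𝕄)) (terminal.from S)

/-- The supremum of the ranks (dimensions of the tensor products with `ℚ`)
of the groups of differences of the monoids `M i`, as a cardinal. -/
def systemRank : Cardinal.{u} :=
  ⨆ i : I, Module.rank ℤ (Algebra.GrothendieckAddGroup (𝕄.obj (op i)))

/-- The combinatorial dimension of the underlying topological space of a scheme; it is `⊥` for the
empty scheme. -/
def dim (X : Scheme.{u}) : WithBot ℕ∞ := topologicalKrullDim X

end System

end ToricScheme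

end

/-! The scheme `X_𝕄(S)` is covered by open pieces `Spec R[M i]`, where `Spec R` runs over an affine
open cover of `S`, because `R[M]` is the tensor product of `R` and `ℤ[M]`. A natural number bounds
the dimension from below exactly when it does so on some piece (`natCast_le_dim_toricScheme_iff`),
so everything reduces to the Krull dimension of `R[M]`, with `M` mapped to its group of differences
`G`.

Lower bound (`le_ringKrullDim_monoidAlgebra`): a rank of at least `r` gives a morphism `M → ℚ^r`
whose differences include the unit vectors. Killing more and more coordinates of `ℚ^r` and reducing
modulo `p` gives morphisms from `R[M]` to the domains `(R/p)[ℚ^r]`. Their kernels are primes, and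
they prolong any chain of primes of `R` by `r` steps.

Upper bounds: along a chain of primes of `R[M]` over a fixed `p`, the transcendence degree of the
residue domain over `R/p` drops strictly. It never exceeds the rank of `G`, since monomials that are
algebraically independent have linearly independent exponents. So the fibres of `Spec R[M] → Spec R`
have dimension at most `r` (`length_le_of_ltSeries_liesOver`), which yields `(r+1) dim R + r`. For
noetherian `R` one passes to a finitely generated submonoid, making the algebra noetherian, and adds
the height of `p` to the height in the fibre. Cancellability enters the upper bounds as injectivity
of `M → G`. -/

section TranscendenceDegree

/-! ### Transcendence degrees of quotients of monoid algebras. -/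

open Cardinal

/-- Otherwise a transcendence basis of `B` lifts to one of `A`, by finiteness. A nonzero element of
the kernel divides a nonzero polynomial in the lifted basis; that polynomial also dies in `B`,
although `f` is injective on such polynomials. -/
lemma trdeg_lt_of_surjective_of_not_injective {R A B : Type u} [CommRing R] [CommRing A]
    [CommRing B] [IsDomain A] [IsDomain B] [Algebra R A] [Algebra R B] [FaithfulSMul R B]
    (f : A →ₐ[R] B) (hf : Function.Surjective f) (hn : ¬ Function.Injective f)
    (hfin : Algebra.trdeg R A < ℵ₀) : Algebra.trdeg R B < Algebra.trdeg R A := by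
  by_contra! h
  have : Nontrivial R := (algebraMap R B).domain_nontrivial
  obtain ⟨s, hs⟩ := exists_isTranscendenceBasis R B
  choose y hy using fun b : s ↦ hf b
  have hfy : f ∘ y = ((↑) : s → B) := funext hy
  have hyi : AlgebraicIndependent R y := AlgebraicIndependent.of_comp f (by rw [hfy]; exact hs.1)
  have hyb : IsTranscendenceBasis R y :=
    hyi.isTranscendenceBasis_of_trdeg_le hfin (by rw [hs.cardinalMk_eq_trdeg]; exact h)
  have := hyb.isAlgebraic
  rw [injective_iff_map_eq_zero] at hn
  push Not at hn
  obtain ⟨a, ha, ha0⟩ := hn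
  obtain ⟨⟨c, hc⟩, hc0, hac⟩ :=
    (Algebra.IsAlgebraic.isAlgebraic (R := Algebra.adjoin R (Set.range y)) a).exists_nonzero_dvd
      (mem_nonZeroDivisors_of_ne_zero ha0)
  replace hac : a ∣ c := hac
  have hfc : f c = 0 := by
    have := map_dvd f hac
    rwa [ha, zero_dvd_iff] at this
  obtain ⟨p, rfl⟩ : ∃ p, MvPolynomial.aeval y p = c := by
    rwa [Algebra.adjoin_range_eq_range_aeval] at hc
  apply hc0
  rw [← AlgHom.comp_apply, MvPolynomial.comp_aeval] at hfc
  have : p = 0 := by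
    have hi := hs.1
    rw [← hfy] at hi
    exact (injective_iff_map_eq_zero _).mp hi p hfc
  subst this
  ext
  simp

/-- The positive and negative parts of an integral relation are two natural combinations with the
same value. If they coincide, every coefficient vanishes, as at most one of its two parts is
nonzero. -/
lemma linearIndependent_int_of_forall_nat {ι G : Type*} [AddCommGroup G] (x : ι → G)
    (h : ∀ a b : ι →₀ ℕ, (a.sum fun i n ↦ n • x i) = (b.sum fun i n ↦ n • x i) → a = b) :
    LinearIndependent ℤ x := by
  rw [linearIndependent_iff]
  intro c hc
  have key := h (c.mapRange Int.toNat rfl) (c.mapRange (fun n ↦ (-n).toNat) rfl) (by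
    rw [← sub_eq_zero, Finsupp.sum_mapRange_index (by simp),
      Finsupp.sum_mapRange_index (by simp), ← Finsupp.sum_sub, ← hc,
      Finsupp.linearCombination_apply]
    refine Finsupp.sum_congr fun i _ ↦ ?_
    rw [← natCast_zsmul, ← natCast_zsmul, ← sub_smul]
    congr 1
    omega)
  ext i
  have := DFunLike.congr_fun key i
  simp only [Finsupp.mapRange_apply] at this
  simp only [Finsupp.coe_zero, Pi.zero_apply]
  omega

/-- The transcendence degree of a domain that is a quotient of a monoid algebra is bounded
by the rank of any group containing the monoid. -/
lemma trdeg_le_rank_of_surjective_monoidAlgebra {R D M G : Type u} [CommRing R] [CommRing D]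
    [IsDomain D] [Algebra R D] [FaithfulSMul R D] [AddCommMonoid M] [AddCommGroup G]
    (f : M →+ G) (hf : Function.Injective f) (φ : AddMonoidAlgebra R M →ₐ[R] D)
    (hφ : Function.Surjective φ) : Algebra.trdeg R D ≤ Module.rank ℤ G := by
  have : Nontrivial R := (algebraMap R D).domain_nontrivial
  let e : M → D := fun m ↦ φ (AddMonoidAlgebra.single m 1)
  have htop : Algebra.adjoin R (Set.range e) = ⊤ := by
    rw [eq_top_iff, ← (AlgHom.range_eq_top φ).mpr hφ]
    rintro _ ⟨b, rfl⟩
    change φ b ∈ _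
    induction b using AddMonoidAlgebra.induction_linear with
    | zero => simp
    | add f g hf hg => rw [map_add]; exact add_mem hf hg
    | single x k =>
      have : AddMonoidAlgebra.single x k = k • AddMonoidAlgebra.single x (1 : R) := by simp
      rw [this, map_smul]
      exact Subalgebra.smul_mem _ (Algebra.subset_adjoin (Set.mem_range_self x)) k
  have halg : Algebra.IsAlgebraic (Algebra.adjoin R (Set.range e)) D := by
    constructor
    intro d
    exact isAlgebraic_algebraMap (⟨d, htop ▸ Algebra.mem_top⟩ : Algebra.adjoin R (Set.range e))
  -- The images of the monomials generate `D`, so a transcendence basis can be chosen among them.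
  obtain ⟨t, ht, hb⟩ := exists_isTranscendenceBasis_subset (R := R) (Set.range e)
  rw [← hb.cardinalMk_eq_trdeg]
  choose m hm using fun d : t ↦ ht d.2
  have hli : LinearIndependent ℤ (fun d ↦ f (m d)) := by
    apply linearIndependent_int_of_forall_nat
    intro a b hab
    have hab' : (a.sum fun i n ↦ n • m i) = (b.sum fun i n ↦ n • m i) := by
      apply hf
      simpa only [Finsupp.sum, map_sum, map_nsmul] using hab
    -- A monomial in the basis is again the image of an element of `M`, so equal exponent sums force
    -- equal values of two monomials, against algebraic independence unless these agree.
    have heval (a : t →₀ ℕ) : MvPolynomial.aeval ((↑) : t → D) (MvPolynomial.monomial a (1 : R)) =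
        e (a.sum fun i n ↦ n • m i) := by
      rw [MvPolynomial.aeval_monomial, map_one, one_mul]
      let E : Multiplicative M →* D := (φ : AddMonoidAlgebra R M →* D).comp
        (AddMonoidAlgebra.of R M)
      change _ = E (Multiplicative.ofAdd (a.sum fun i n ↦ n • m i))
      rw [Finsupp.sum, ofAdd_sum, map_prod, Finsupp.prod]
      refine Finset.prod_congr rfl fun i _ ↦ ?_
      rw [ofAdd_nsmul, map_pow]
      congr 1
      exact (hm i).symm
    have := hb.1 ((heval a).trans ((congrArg e hab').trans (heval b).symm))
    exact (MvPolynomial.monomial_left_inj one_ne_zero).mp this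
  exact hli.cardinal_le_rank

end TranscendenceDegree

/-! ### Upper bounds for the Krull dimension of a monoid algebra. -/

section KrullDimension

open Cardinal

variable {R M G : Type u} [CommRing R] [AddCommMonoid M] [AddCommGroup G]

lemma trdeg_quotient_le_rank (f : M →+ G) (hf : Function.Injective f) (p : Ideal R)
    (q : Ideal (AddMonoidAlgebra R M)) [q.IsPrime] [q.LiesOver p] :
    Algebra.trdeg (R ⧸ p) (AddMonoidAlgebra R M ⧸ q) ≤ Module.rank ℤ G := by
  let E : Multiplicative M →* AddMonoidAlgebra R M ⧸ q :=
    (Ideal.Quotient.mk q : AddMonoidAlgebra R M →* _).comp (AddMonoidAlgebra.of R M)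
  refine trdeg_le_rank_of_surjective_monoidAlgebra f hf
    (AddMonoidAlgebra.lift (R ⧸ p) (AddMonoidAlgebra R M ⧸ q) M E) fun d ↦ ?_
  obtain ⟨b, rfl⟩ := Ideal.Quotient.mk_surjective d
  induction b using AddMonoidAlgebra.induction_linear with
  | zero => exact ⟨0, by simp⟩
  | add f g hf hg =>
    obtain ⟨a, ha⟩ := hf
    obtain ⟨b, hb⟩ := hg
    exact ⟨a + b, by rw [map_add, map_add, ha, hb]⟩
  | single x k =>
    refine ⟨AddMonoidAlgebra.single x (Ideal.Quotient.mk p k), ?_⟩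
    rw [AddMonoidAlgebra.lift_single]
    have : AddMonoidAlgebra.single x k = k • AddMonoidAlgebra.single x (1 : R) := by simp
    rw [this]
    rfl

lemma trdeg_quotient_lt_of_lt {A : Type u} [CommRing A] [Algebra R A] (p : Ideal R)
    (q₁ q₂ : Ideal A) [q₁.IsPrime] [q₂.IsPrime] [q₁.LiesOver p] [q₂.LiesOver p] (h : q₁ < q₂)
    (hfin : Algebra.trdeg (R ⧸ p) (A ⧸ q₁) < ℵ₀) :
    Algebra.trdeg (R ⧸ p) (A ⧸ q₂) < Algebra.trdeg (R ⧸ p) (A ⧸ q₁) := by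
  let g : A ⧸ q₁ →ₐ[R ⧸ p] A ⧸ q₂ :=
    { Ideal.Quotient.factor h.le with
      commutes' := fun r ↦ by
        obtain ⟨r, rfl⟩ := Ideal.Quotient.mk_surjective r
        rfl }
  refine trdeg_lt_of_surjective_of_not_injective g (Ideal.Quotient.factor_surjective h.le) ?_ hfin
  intro hi
  obtain ⟨a, ha2, ha1⟩ := SetLike.exists_of_lt h
  apply ha1
  rw [← Ideal.Quotient.eq_zero_iff_mem]
  apply hi
  rw [map_zero]
  exact Ideal.Quotient.eq_zero_iff_mem.mpr ha2

/-- The transcendence degrees over `R/p` form a strictly decreasing sequence in `{0, …, r}`. Any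
ambient group `G` is allowed, so that the bound passes to submonoids of `M` with the same `G`. -/
lemma length_le_of_ltSeries_liesOver (f : M →+ G) (hf : Function.Injective f) {r : ℕ}
    (hr : Module.rank ℤ G ≤ r) (p : PrimeSpectrum R)
    (l : LTSeries (PrimeSpectrum (AddMonoidAlgebra R M)))
    (hl : ∀ i, (l i).asIdeal.LiesOver p.asIdeal) : l.length ≤ r := by
  let d (i : Fin (l.length + 1)) : Cardinal.{u} :=
    haveI := hl i
    Algebra.trdeg (R ⧸ p.asIdeal) (AddMonoidAlgebra R M ⧸ (l i).asIdeal)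
  have hd (i) : d i ≤ r :=
    haveI := hl i
    (trdeg_quotient_le_rank f hf p.asIdeal (l i).asIdeal).trans hr
  have hfin (i) : d i < ℵ₀ := (hd i).trans_lt (natCast_lt_aleph0)
  have hlt {i j} (hij : i < j) : d j < d i :=
    haveI := hl i
    haveI := hl j
    trdeg_quotient_lt_of_lt p.asIdeal (l i).asIdeal (l j).asIdeal (l.strictMono hij) (hfin i)
  have key : StrictAnti fun i ↦ (d i).toNat := fun i j hij ↦
    toNat_lt_toNat (hlt hij) (hfin i)
  let m : Fin (l.length + 1) → Fin (r + 1) := fun i ↦ ⟨(d i).toNat, by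
    have := toNat_le_toNat (hd i) (natCast_lt_aleph0)
    rw [toNat_natCast] at this
    omega⟩
  have hm : Function.Injective m := fun i j hij ↦ key.injective (congrArg Fin.val hij)
  simpa using Fintype.card_le_of_injective m hm

/-- A chain contracting to `n + 1` primes of `R` has at most `r + 1` members over each, so its
length is at most `(n + 1)(r + 1) - 1 = (r + 1) n + r`. -/
lemma ringKrullDim_monoidAlgebra_le (f : M →+ G) (hf : Function.Injective f) {r : ℕ}
    (hr : Module.rank ℤ G ≤ r) :
    ringKrullDim (AddMonoidAlgebra R M) ≤
      ((r : WithBot ℕ∞) + 1) * ringKrullDim R + (r : WithBot ℕ∞) := by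
  apply Order.krullDim_le_of_krullDim_preimage_le' (m := r)
    (PrimeSpectrum.comap (algebraMap R (AddMonoidAlgebra R M)))
    (fun _ _ h ↦ Ideal.comap_mono h) fun p ↦ ?_
  refine iSup_le fun l ↦ ?_
  have := length_le_of_ltSeries_liesOver f hf hr p (l.map Subtype.val fun _ _ h ↦ h)
    fun i ↦ ⟨congrArg PrimeSpectrum.asIdeal (l i).2.symm⟩
  exact_mod_cast this

/-- Contraction of a chain of primes to the monoid algebra of a suitable finitely generated
submonoid preserves strictness. -/
lemma exists_fg_le_ringKrullDim_monoidAlgebra {n : ℕ}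
    (h : (n : WithBot ℕ∞) ≤ ringKrullDim (AddMonoidAlgebra R M)) :
    ∃ N : AddSubmonoid M, N.FG ∧ (n : WithBot ℕ∞) ≤ ringKrullDim (AddMonoidAlgebra R N) := by
  classical
  obtain ⟨l, rfl⟩ := Order.le_krullDim_iff.mp h
  have hex (i : Fin l.length) := SetLike.exists_of_lt
    (show (l i.castSucc).asIdeal < (l i.succ).asIdeal from l.strictMono i.castSucc_lt_succ)
  choose a ha₂ ha₁ using hex
  -- Each strict inclusion is witnessed by one element with finite support; the supports together
  -- generate a submonoid whose algebra contains all the witnesses.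
  let T : Finset M := Finset.univ.biUnion fun i ↦ (a i).coeff.support
  let N := AddSubmonoid.closure (T : Set M)
  let ι : AddMonoidAlgebra R N →+* AddMonoidAlgebra R M :=
    AddMonoidAlgebra.mapDomainRingHom R N.subtype
  have hmem (i) : a i ∈ ι.range := by
    have hs : ∀ x ∈ (a i).coeff.support, x ∈ N := fun x hx ↦
      AddSubmonoid.subset_closure (Finset.mem_biUnion.mpr ⟨i, Finset.mem_univ i, hx⟩)
    rw [← AddMonoidAlgebra.sum_coeff_single (a i)]
    refine sum_mem fun x hx ↦ ⟨AddMonoidAlgebra.single ⟨x, hs x hx⟩ ((a i).coeff x), ?_⟩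
    simp [ι]
  choose b hb using hmem
  refine ⟨N, ⟨T, rfl⟩, Order.le_krullDim_iff.mpr ⟨⟨l.length, fun i ↦ (l i).comap ι, fun i ↦ ?_⟩, rfl⟩⟩
  refine lt_of_le_of_ne (Ideal.comap_mono (l.strictMono i.castSucc_lt_succ).le) fun heq ↦ ha₁ i ?_
  have : b i ∈ ((l i.succ).comap ι).asIdeal := by
    change ι (b i) ∈ (l i.succ).asIdeal
    rw [hb]
    exact ha₂ i
  replace this : b i ∈ ((l i.castSucc).asIdeal).comap ι := by
    rw [show (l i.castSucc).asIdeal.comap ι = (l i.succ).asIdeal.comap ι from heq]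
    exact this
  change ι (b i) ∈ (l i.castSucc).asIdeal at this
  rwa [hb] at this

lemma ringKrullDim_monoidAlgebra_le_of_fg [IsNoetherianRing R] [AddMonoid.FG M] (f : M →+ G)
    (hf : Function.Injective f) {r : ℕ} (hr : Module.rank ℤ G ≤ r) :
    ringKrullDim (AddMonoidAlgebra R M) ≤ ringKrullDim R + (r : WithBot ℕ∞) := by
  have : IsNoetherianRing (AddMonoidAlgebra R M) :=
    Algebra.FiniteType.isNoetherianRing R (AddMonoidAlgebra R M)
  rw [ringKrullDim_le_iff_height_le]
  intro P hP
  let p := P.under R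
  have hle := Ideal.height_le_height_add_of_liesOver p P
  let J := p.map (algebraMap R (AddMonoidAlgebra R M))
  let Q := P.map (Ideal.Quotient.mk J)
  have hJP : J ≤ P := Ideal.map_comap_le
  have hQ : Q.IsPrime := Ideal.map_isPrime_of_surjective Ideal.Quotient.mk_surjective
    (by rwa [Ideal.mk_ker])
  have hQP : Q.comap (Ideal.Quotient.mk J) = P := by
    rw [Ideal.comap_map_of_surjective' _ Ideal.Quotient.mk_surjective, Ideal.mk_ker]
    exact sup_eq_left.mpr hJP
  have hQr : Q.height ≤ r := by
    obtain ⟨l, hl, hlen⟩ := Q.exists_ltSeries_length_eq_height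
    rw [← hlen, Nat.cast_le]
    let m : LTSeries (PrimeSpectrum (AddMonoidAlgebra R M)) :=
      l.map (PrimeSpectrum.comap (Ideal.Quotient.mk J)) fun x y h ↦
        (Ideal.orderEmbeddingOfSurjective _ Ideal.Quotient.mk_surjective).strictMono h
    have : p.IsPrime := inferInstance
    -- The members of the chain pull back to primes between `J = p R[M]` and `P`, so all of them
    -- contract to `p`.
    refine length_le_of_ltSeries_liesOver f hf hr ⟨p, this⟩ m fun i ↦ ⟨le_antisymm ?_ ?_⟩
    · refine Ideal.map_le_iff_le_comap.mp (?_ : J ≤ _)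
      intro x hx
      change Ideal.Quotient.mk J x ∈ (l i).asIdeal
      rw [Ideal.Quotient.eq_zero_iff_mem.mpr hx]
      exact zero_mem _
    · refine Ideal.comap_mono (?_ : _ ≤ P)
      rw [← hQP]
      refine Ideal.comap_mono ?_
      have := l.monotone (Fin.le_last i)
      change l i ≤ RelSeries.last l at this
      rw [hl] at this
      exact this
  have hp : (p.height : WithBot ℕ∞) ≤ ringKrullDim R :=
    Ideal.height_le_ringKrullDim_of_ne_top Ideal.IsPrime.ne_top'
  calc (P.height : WithBot ℕ∞) ≤ ((p.height + Q.height : ℕ∞) : WithBot ℕ∞) := by exact_mod_cast hle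
    _ ≤ ringKrullDim R + (r : WithBot ℕ∞) := by
      rw [WithBot.coe_add]
      exact add_le_add hp (by exact_mod_cast hQr)

/-- Reduces inequalities of dimensions to finite chains, which spares separate arguments for
infinite dimension and the empty scheme. -/
lemma WithBot.ENat.le_of_forall_natCast_le {a b : WithBot ℕ∞}
    (h : ∀ n : ℕ, (n : WithBot ℕ∞) ≤ a → (n : WithBot ℕ∞) ≤ b) : a ≤ b := by
  induction a with
  | bot => exact bot_le
  | coe a =>
    have h0 := h 0 (by exact_mod_cast (zero_le : 0 ≤ a))
    induction b with
    | bot => simp at h0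
    | coe b =>
      refine WithBot.coe_le_coe.mpr (ENat.forall_natCast_le_iff_le.mp fun n hn ↦ ?_)
      exact_mod_cast h n (by exact_mod_cast hn)

lemma ringKrullDim_monoidAlgebra_le_of_isNoetherianRing [IsNoetherianRing R] (f : M →+ G)
    (hf : Function.Injective f) {r : ℕ} (hr : Module.rank ℤ G ≤ r) :
    ringKrullDim (AddMonoidAlgebra R M) ≤ ringKrullDim R + (r : WithBot ℕ∞) := by
  refine WithBot.ENat.le_of_forall_natCast_le fun n hn ↦ ?_
  obtain ⟨N, hN, h⟩ := exists_fg_le_ringKrullDim_monoidAlgebra hn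
  have : AddMonoid.FG N := (AddMonoid.fg_iff_addSubmonoid_fg N).mpr hN
  exact h.trans (ringKrullDim_monoidAlgebra_le_of_fg (f.comp N.subtype)
    (hf.comp Subtype.val_injective) hr)

end KrullDimension

/-! ### Lower bound for the Krull dimension of a monoid algebra. -/

section LowerBound

variable {R M G : Type u} [CommRing R] [AddCommMonoid M] [AddCommGroup G]

lemma exists_hom_rat_of_le_rank {r : ℕ} (hr : (r : Cardinal.{u}) ≤ Module.rank ℤ G) :
    ∃ φ : G →+ (Fin r → ℚ), ∀ i, ∃ g, φ g = Pi.single i 1 := by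
  obtain ⟨b, hb⟩ := Module.le_rank_iff_exists_linearMap.mp hr
  -- Since `ℚ^r` is divisible, hence injective, the inclusion of `ℤ^r` extends along `b : ℤ^r → G`.
  obtain ⟨φ, hφ⟩ := Module.Baer.extension_property (Module.Baer.of_divisible (Fin r → ℚ)) b hb
    ((Int.castAddHom ℚ).toIntLinearMap.compLeft (Fin r))
  refine ⟨φ.toAddMonoidHom, fun i ↦ ⟨b (Pi.single i 1), ?_⟩⟩
  refine (LinearMap.congr_fun hφ (Pi.single i 1)).trans ?_
  ext j
  simp [Pi.single_apply]

/-- The projection of `ℚ ^ r` that kills the coordinates with index less than `i`. -/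
def truncation (r i : ℕ) : (Fin r → ℚ) →+ (Fin r → ℚ) where
  toFun x j := if (j : ℕ) < i then 0 else x j
  map_zero' := by ext; simp
  map_add' x y := by ext j; by_cases h : (j : ℕ) < i <;> simp [h]

lemma truncation_comp_truncation (r : ℕ) {i j : ℕ} (h : i ≤ j) :
    (truncation r j).comp (truncation r i) = truncation r j := by
  refine AddMonoidHom.ext fun x ↦ funext fun k ↦ ?_
  change (if (k : ℕ) < j then 0 else if (k : ℕ) < i then 0 else x k) =
    if (k : ℕ) < j then 0 else x k
  split_ifs <;> first | rfl | omega

/-- The reduction of a monoid algebra modulo an ideal of coefficients and along a morphism of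
monoids. -/
noncomputable def reduction {V : Type*} [AddCommMonoid V] (p : Ideal R) (φ : M →+ V) :
    AddMonoidAlgebra R M →+* AddMonoidAlgebra (R ⧸ p) V :=
  (AddMonoidAlgebra.mapRingHom V (Ideal.Quotient.mk p)).comp
    (AddMonoidAlgebra.mapDomainRingHom R φ)

lemma reduction_single {V : Type*} [AddCommMonoid V] (p : Ideal R) (φ : M →+ V) (m : M) (a : R) :
    reduction p φ (AddMonoidAlgebra.single m a) =
      AddMonoidAlgebra.single (φ m) (Ideal.Quotient.mk p a) := by
  simp [reduction]

lemma ker_reduction_mono {V W : Type*} [AddCommMonoid V] [AddCommMonoid W] {p q : Ideal R}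
    (h : p ≤ q) (φ : M →+ V) (ψ : V →+ W) :
    RingHom.ker (reduction p φ) ≤ RingHom.ker (reduction q (ψ.comp φ)) := by
  have : reduction q (ψ.comp φ) = ((AddMonoidAlgebra.mapRingHom W (Ideal.Quotient.factor h)).comp
      (AddMonoidAlgebra.mapDomainRingHom (R ⧸ p) ψ)).comp (reduction p φ) := by
    apply AddMonoidAlgebra.ringHom_ext <;> intro x <;>
      simp [reduction_single]
  intro x hx
  rw [RingHom.mem_ker] at hx ⊢
  rw [this, RingHom.comp_apply, hx, map_zero]

/-- The prime ideal cut out by a prime ideal of coefficients and a truncation. -/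
noncomputable def truncationPrime {r : ℕ} (φ : M →+ (Fin r → ℚ)) (p : PrimeSpectrum R) (i : ℕ) :
    PrimeSpectrum (AddMonoidAlgebra R M) :=
  ⟨RingHom.ker (reduction p.asIdeal ((truncation r i).comp φ)), by
    have : IsDomain (AddMonoidAlgebra (R ⧸ p.asIdeal) (Fin r → ℚ)) :=
      NoZeroDivisors.to_isDomain _
    exact RingHom.ker_isPrime _⟩

lemma truncationPrime_mono {r : ℕ} (φ : M →+ (Fin r → ℚ)) {p q : PrimeSpectrum R} (h : p ≤ q)
    {i j : ℕ} (hij : i ≤ j) : truncationPrime φ p i ≤ truncationPrime φ q j := by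
  have := ker_reduction_mono h ((truncation r i).comp φ) (truncation r j)
  rwa [← AddMonoidHom.comp_assoc, truncation_comp_truncation r hij] at this

lemma truncationPrime_lt_of_lt_left {r : ℕ} (φ : M →+ (Fin r → ℚ)) {p q : PrimeSpectrum R}
    (h : p < q) (i : ℕ) : truncationPrime φ p i < truncationPrime φ q i := by
  refine lt_of_le_not_ge (truncationPrime_mono φ h.le le_rfl) fun hle ↦ ?_
  -- A constant in `q` but not in `p` separates the two primes.
  obtain ⟨a, ha, ha'⟩ := SetLike.exists_of_lt (show p.asIdeal < q.asIdeal from h)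
  have key : AddMonoidAlgebra.single (0 : M) a ∈ (truncationPrime φ q i).asIdeal := by
    change reduction _ _ _ = 0
    rw [reduction_single, Ideal.Quotient.eq_zero_iff_mem.mpr ha, AddMonoidAlgebra.single_zero]
  have := hle key
  change reduction _ _ _ = 0 at this
  rw [reduction_single, AddMonoidAlgebra.single_eq_zero, Ideal.Quotient.eq_zero_iff_mem] at this
  exact ha' this

lemma truncationPrime_lt_of_lt_right {r : ℕ} (φ : M →+ (Fin r → ℚ))
    (hφ : ∀ i, ∃ m n, φ m - φ n = Pi.single i 1) (p : PrimeSpectrum R) {i j : ℕ} (hij : i < j)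
    (hi : i < r) : truncationPrime φ p i < truncationPrime φ p j := by
  refine lt_of_le_not_ge (truncationPrime_mono φ le_rfl hij.le) fun hle ↦ ?_
  -- The separating element is the difference of the monomials of `m` and `n`: their exponents
  -- differ by the `i`-th unit vector, which truncation at `j > i` kills and truncation at `i`
  -- keeps.
  obtain ⟨m, n, hmn⟩ := hφ ⟨i, hi⟩
  have hj : truncation r j (φ m) = truncation r j (φ n) := by
    rw [← sub_eq_zero, ← map_sub, hmn]
    ext k
    change (if (k : ℕ) < j then 0 else (Pi.single _ 1 : Fin r → ℚ) k) = 0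
    split_ifs with hk
    · rfl
    · rw [Pi.single_eq_of_ne]
      rintro rfl
      exact hk hij
  have key : AddMonoidAlgebra.single m (1 : R) - AddMonoidAlgebra.single n 1 ∈
      (truncationPrime φ p j).asIdeal := by
    change reduction _ _ _ = 0
    rw [map_sub, reduction_single, reduction_single, sub_eq_zero]
    exact congrArg (AddMonoidAlgebra.single · _) hj
  have := hle key
  change reduction _ _ _ = 0 at this
  rw [map_sub, reduction_single, reduction_single, sub_eq_zero, map_one] at this
  have h := AddMonoidAlgebra.single_left_injective one_ne_zero this
  replace h : truncation r i (φ m - φ n) = 0 := by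
    rw [map_sub, sub_eq_zero]
    exact h
  rw [hmn] at h
  have := congrFun h ⟨i, hi⟩
  change (if i < i then 0 else (Pi.single _ 1 : Fin r → ℚ) ⟨i, hi⟩) = 0 at this
  simp at this

lemma WithBot.ENat.add_natCast_le_of_forall {a b : WithBot ℕ∞} {r : ℕ}
    (h : ∀ n : ℕ, (n : WithBot ℕ∞) ≤ a → ((n + r : ℕ) : WithBot ℕ∞) ≤ b) :
    a + (r : WithBot ℕ∞) ≤ b := by
  refine WithBot.ENat.le_of_forall_natCast_le fun n hn ↦ ?_
  induction a with
  | bot => simp at hn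
  | coe a =>
    have hn' : (n : ℕ∞) ≤ a + r := by exact_mod_cast hn
    have : ((n - r : ℕ) : ℕ∞) ≤ a := by
      -- Truncated subtraction is harmless: for `n < r` the hypothesis is used at `0` and gives more
      -- than needed.
      rw [ENat.natCast_sub]
      exact tsub_le_iff_right.mpr hn'
    refine le_trans ?_ (h (n - r) (WithBot.coe_le_coe.mpr this))
    exact_mod_cast (by omega : n ≤ n - r + r)

/-- The Krull dimension of a monoid algebra is at least that of the ring of coefficients plus the
rank of any group generated by the image of the monoid. -/
lemma le_ringKrullDim_monoidAlgebra (f : M →+ G) (hf : ∀ g, ∃ m n, f m - f n = g) {r : ℕ}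
    (hr : (r : Cardinal.{u}) ≤ Module.rank ℤ G) :
    ringKrullDim R + (r : WithBot ℕ∞) ≤ ringKrullDim (AddMonoidAlgebra R M) := by
  obtain ⟨ψ, hψ⟩ := exists_hom_rat_of_le_rank hr
  let φ : M →+ (Fin r → ℚ) := ψ.comp f
  have hφ (i) : ∃ m n, φ m - φ n = Pi.single i 1 := by
    obtain ⟨g, hg⟩ := hψ i
    obtain ⟨m, n, rfl⟩ := hf g
    exact ⟨m, n, by rw [← hg, map_sub]; rfl⟩
  refine WithBot.ENat.add_natCast_le_of_forall fun n hn ↦ ?_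
  obtain ⟨l, rfl⟩ := Order.le_krullDim_iff.mp hn
  -- The first `l.length` steps climb the chain in `R` without truncating; the last `r` steps keep
  -- its top prime and kill one more coordinate each.
  refine Order.le_krullDim_iff.mpr ⟨⟨l.length + r, fun k ↦
    truncationPrime φ (l ⟨min k l.length, by omega⟩) (k - l.length), fun k ↦ ?_⟩, rfl⟩
  change truncationPrime φ (l ⟨min k l.length, _⟩) (k - l.length) <
    truncationPrime φ (l ⟨min (k + 1) l.length, _⟩) (k + 1 - l.length)
  rcases lt_or_ge (k : ℕ) l.length with h | h
  · rw [Nat.sub_eq_zero_of_le h.le, Nat.sub_eq_zero_of_le h]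
    refine truncationPrime_lt_of_lt_left φ (l.strictMono ?_) 0
    rw [Fin.lt_def]
    simp only
    omega
  · have : (⟨min k l.length, by omega⟩ : Fin (l.length + 1)) = ⟨min (k + 1) l.length, by omega⟩ := by
      simp only [Fin.mk.injEq]
      omega
    rw [this]
    exact truncationPrime_lt_of_lt_right φ hφ _ (by omega) (by omega)

end LowerBound

/-! ### Krull dimension and open covers. -/

section OpenCover

lemma le_topologicalKrullDim_iff_of_isOpenEmbedding {ι X : Type*} [TopologicalSpace X]
    {U : ι → Type*} [∀ i, TopologicalSpace (U i)] (f : ∀ i, U i → X)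
    (hf : ∀ i, Topology.IsOpenEmbedding (f i)) (hcov : ∀ x, ∃ i y, f i y = x) (n : ℕ) :
    (n : WithBot ℕ∞) ≤ topologicalKrullDim X ↔
      ∃ i, (n : WithBot ℕ∞) ≤ topologicalKrullDim (U i) := by
  refine ⟨fun h ↦ ?_, fun ⟨i, hi⟩ ↦ hi.trans (hf i).isInducing.topologicalKrullDim_le⟩
  obtain ⟨l, rfl⟩ := Order.le_krullDim_iff.mp h
  -- A member of the cover containing a point of the smallest closed set meets every set of the
  -- chain, and irreducible closed sets meeting an open set correspond to those of the open set.
  obtain ⟨x, hx⟩ := (l 0).isIrreducible.nonempty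
  obtain ⟨i, y, rfl⟩ := hcov x
  refine ⟨i, Order.le_krullDim_iff.mpr ⟨⟨l.length, fun k ↦
    (TopologicalSpace.IrreducibleCloseds.orderIsoOfIsOpenEmbedding (f i) (hf i)).symm
      ⟨l k, y, l.monotone (Fin.zero_le k) hx⟩, fun k ↦ ?_⟩, rfl⟩⟩
  refine (TopologicalSpace.IrreducibleCloseds.orderIsoOfIsOpenEmbedding
    (f i) (hf i)).symm.strictMono ?_
  exact l.strictMono k.castSucc_lt_succ

end OpenCover

namespace ToricScheme

lemma natCast_le_dim_iff_exists {X : Scheme.{u}} (𝒰 : X.OpenCover) (n : ℕ) :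
    (n : WithBot ℕ∞) ≤ dim X ↔ ∃ i, (n : WithBot ℕ∞) ≤ dim (𝒰.X i) :=
  le_topologicalKrullDim_iff_of_isOpenEmbedding (fun i ↦ (𝒰.f i : 𝒰.X i → X))
    (fun i ↦ (𝒰.f i).isOpenEmbedding) (fun x ↦ 𝒰.exists_eq x) n

lemma dim_eq_of_iso {X Y : Scheme.{u}} (e : X ≅ Y) : dim X = dim Y :=
  IsHomeomorph.topologicalKrullDim_eq _ (Scheme.homeoOfIso e).isHomeomorph

lemma dim_Spec (R : CommRingCat.{u}) : dim (Spec R) = ringKrullDim R :=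
  PrimeSpectrum.topologicalKrullDim_eq_ringKrullDim R

/-! ### Base change of monoid rings. -/

section BaseChange

variable (R : Type u) [CommRing R] (M : Type u) [AddCommMonoid M]

variable {R M} in
/-- The morphism on the monoid algebra over `R` given by morphisms on `R` and on the monoid ring
over the integers. -/
noncomputable def monoidAlgebraDesc {T : Type u} [CommRing T] (f : AddMonoidAlgebra ℤ M →+* T)
    (g : R →+* T) : AddMonoidAlgebra R M →+* T :=
  AddMonoidAlgebra.liftNCRingHom g ((f : _ →* _).comp (AddMonoidAlgebra.of ℤ M))
    fun _ _ ↦ Commute.all _ _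

lemma monoidAlgebraDesc_comp_mapRingHom {T : Type u} [CommRing T]
    (f : AddMonoidAlgebra ℤ M →+* T) (g : R →+* T) :
    (monoidAlgebraDesc f g).comp (AddMonoidAlgebra.mapRingHom M (Int.castRingHom R)) = f := by
  apply AddMonoidAlgebra.ringHom_ext
  · intro n
    have : (AddMonoidAlgebra.single (0 : M) n : AddMonoidAlgebra ℤ M) = (n : AddMonoidAlgebra ℤ M) := rfl
    rw [this, map_intCast, map_intCast]
  · intro x
    simp [monoidAlgebraDesc]

lemma monoidAlgebraDesc_comp_singleZeroRingHom {T : Type u} [CommRing T]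
    (f : AddMonoidAlgebra ℤ M →+* T) (g : R →+* T) :
    (monoidAlgebraDesc f g).comp AddMonoidAlgebra.singleZeroRingHom = g := by
  ext x
  refine (AddMonoidAlgebra.liftNCRingHom_single _ _ (fun _ _ ↦ Commute.all _ _) _ _).trans ?_
  simp [← AddMonoidAlgebra.one_def]

lemma eq_monoidAlgebraDesc {T : Type u} [CommRing T] (m : AddMonoidAlgebra R M →+* T) :
    m = monoidAlgebraDesc (m.comp (AddMonoidAlgebra.mapRingHom M (Int.castRingHom R)))
      (m.comp AddMonoidAlgebra.singleZeroRingHom) := by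
  apply AddMonoidAlgebra.ringHom_ext <;> intro x <;>
    simp [monoidAlgebraDesc, ← map_mul, AddMonoidAlgebra.single_mul_single]

/-- The monoid algebra over `R` is the coproduct of `R` and of the monoid ring over the integers. -/
noncomputable def monoidAlgebraIsCoproduct : IsColimit (BinaryCofan.mk
    (P := CommRingCat.of (AddMonoidAlgebra R M))
    (CommRingCat.ofHom (AddMonoidAlgebra.mapRingHom M (Int.castRingHom R)) :
      CommRingCat.of (AddMonoidAlgebra ℤ M) ⟶ _)
    (CommRingCat.ofHom AddMonoidAlgebra.singleZeroRingHom : CommRingCat.of R ⟶ _)) :=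
  BinaryCofan.IsColimit.mk _ (fun f g ↦ CommRingCat.ofHom (monoidAlgebraDesc f.hom g.hom))
    (fun f g ↦ CommRingCat.hom_ext (monoidAlgebraDesc_comp_mapRingHom R M f.hom g.hom))
    (fun f g ↦ CommRingCat.hom_ext (monoidAlgebraDesc_comp_singleZeroRingHom R M f.hom g.hom))
    (fun f g m hf hg ↦ by
      subst hf hg
      exact CommRingCat.hom_ext (eq_monoidAlgebraDesc R M m.hom))

lemma nonempty_pullback_iso_Spec (a : Spec (CommRingCat.of (AddMonoidAlgebra ℤ M)) ⟶ ⊤_ Scheme.{u})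
    (b : Spec (CommRingCat.of R) ⟶ ⊤_ Scheme.{u}) :
    Nonempty (pullback a b ≅ Spec (CommRingCat.of (AddMonoidAlgebra R M))) := by
  have h := isPullback_SpecMap_of_isPushout _ _ _ _
    (IsPushout.of_is_coproduct' (monoidAlgebraIsCoproduct R M) CommRingCat.isInitial)
  -- The pullback is over the spectrum of the lifted integers; it is moved to the chosen terminal
  -- scheme, where compatibility with `a` and `b` is automatic.
  have h' : IsPullback _ _ a b := IsPullback.of_iso h (Iso.refl _) (Iso.refl _) (Iso.refl _)
    (specULiftZIsTerminal.uniqueUpToIso terminalIsTerminal) (by simp; rfl) (by simp; rfl)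
    (Subsingleton.elim _ _) (Subsingleton.elim _ _)
  exact ⟨h'.isoPullback.symm⟩

end BaseChange

/-! ### The affine open cover of the toric scheme. -/

section Charts

variable {I : Type u} [SemilatticeInf I]

/-- The enlarged system adds no points: every piece maps to the gluing through the whole member
containing it. -/
lemma glueCocone_jointly_surjective (F : I ⥤ Scheme.{u}) [Glueable F] (x : (glueCocone F).pt) :
    ∃ i y, (glueCocone F).ι.app i y = x := by
  obtain ⟨a, z, rfl⟩ := Scheme.IsLocallyDirected.ι_jointly_surjective (pieces F) x
  refine ⟨a.idx, a.incl z, ?_⟩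
  change (a.incl ≫ toWhole F a.idx ≫ colimit.ι (pieces F) (Piece.whole a.idx)) z = _
  have h := colimit.w (pieces F) (homOfLE (Piece.le_whole F (le_refl a.idx)))
  rw [pieces_map_whole F (le_refl a.idx)] at h
  have hid : F.map (homOfLE (le_refl a.idx)) = 𝟙 _ := F.map_id _
  rw [hid, Category.id_comp, Category.assoc] at h
  rw [h]

/-- The open cover of the inductive limit of a glueable system by its members. -/
noncomputable def colimitOpenCover (F : I ⥤ Scheme.{u}) [Glueable F] : (colimit F).OpenCover := by
  let e := (glueCoconeIsColimit F).coconePointUniqueUpToIso (colimit.isColimit F)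
  have he (i) : (glueCocone F).ι.app i ≫ e.hom = colimit.ι F i :=
    IsColimit.comp_coconePointUniqueUpToIso_hom _ _ _
  refine Scheme.Cover.mkOfCovers I F.obj (colimit.ι F) (fun x ↦ ?_) fun i ↦ ?_
  · obtain ⟨i, y, hy⟩ := glueCocone_jointly_surjective F (e.inv x)
    refine ⟨i, y, ?_⟩
    rw [← he, Scheme.Hom.comp_apply, hy, ← Scheme.Hom.comp_apply, e.inv_hom_id]
    rfl
  · rw [← he]
    infer_instance

lemma natCast_le_dim_toricScheme_iff (𝕄 : Iᵒᵖ ⥤ AddCommMonCat.{u}) [OpenlyImmersive 𝕄]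
    [Cancellable 𝕄] (S : Scheme.{u}) (n : ℕ) :
    (n : WithBot ℕ∞) ≤ dim (toricScheme 𝕄 S) ↔ ∃ (i : I) (j : S.affineOpenCover.I₀),
      (n : WithBot ℕ∞) ≤
        ringKrullDim (AddMonoidAlgebra (S.affineOpenCover.X j) (𝕄.obj (op i))) := by
  refine (natCast_le_dim_iff_exists (Scheme.Pullback.openCoverOfLeftRight
    (colimitOpenCover (charts 𝕄)) S.affineOpenCover.openCover (terminal.from (toricSchemeInt 𝕄))
    (terminal.from S)) n).trans (Prod.exists.trans ?_)
  refine exists_congr fun i ↦ exists_congr fun j ↦ ?_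
  obtain ⟨e⟩ := nonempty_pullback_iso_Spec (S.affineOpenCover.X j) (𝕄.obj (op i))
    (colimit.ι (charts 𝕄) i ≫ terminal.from _) (S.affineOpenCover.f j ≫ terminal.from S)
  exact iff_of_eq (congrArg _ ((dim_eq_of_iso e).trans (dim_Spec _)))

end Charts

end ToricScheme

namespace ToricScheme

/-! ### Groups of differences and attainment of the rank. -/

section Rank

open Cardinal

/-- The canonical morphism from a monoid to its group of differences. -/
noncomputable def toDifferences (M : Type u) [AddCommMonoid M] :
    M →+ Algebra.GrothendieckAddGroup M :=
  (AddLocalization.addMonoidOf ⊤).toAddMonoidHom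

lemma toDifferences_injective (M : Type u) [AddCommMonoid M] [IsCancelAdd M] :
    Function.Injective (toDifferences M) :=
  fun _ _ h ↦ AddLocalization.mk_left_injective (s := ⊤) 0 h

lemma exists_toDifferences_sub_eq (M : Type u) [AddCommMonoid M]
    (g : Algebra.GrothendieckAddGroup M) : ∃ m n, toDifferences M m - toDifferences M n = g := by
  obtain ⟨⟨m, n⟩, h⟩ := (AddLocalization.addMonoidOf (⊤ : AddSubmonoid M)).surj g
  exact ⟨m, n, (eq_sub_iff_add_eq.mpr h).symm⟩

variable {I : Type u} [SemilatticeInf I] (𝕄 : Iᵒᵖ ⥤ AddCommMonCat.{u}) {r : ℕ}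

lemma rank_le_of_systemRank_eq (hr : systemRank 𝕄 = r) (i : I) :
    Module.rank ℤ (Algebra.GrothendieckAddGroup (𝕄.obj (op i))) ≤ r :=
  (le_ciSup Cardinal.bddAbove_of_small i).trans hr.le

/-- A finite supremum of cardinals is attained: if all ranks were below `r + 1`, then `r` would
already bound them. -/
lemma exists_le_rank_of_systemRank_eq [Nonempty I] (hr : systemRank 𝕄 = r) :
    ∃ i, (r : Cardinal.{u}) ≤ Module.rank ℤ (Algebra.GrothendieckAddGroup (𝕄.obj (op i))) := by
  by_contra! h
  cases r with
  | zero => exact absurd (h (Classical.arbitrary I)) (by simp)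
  | succ r =>
    have : systemRank 𝕄 ≤ r := ciSup_le fun i ↦ by
      have := h i
      rw [Nat.cast_succ, ← Cardinal.succ_natCast] at this
      exact Order.lt_succ_iff.mp this
    rw [hr, Nat.cast_le] at this
    omega

end Rank

end ToricScheme

/-! ### The dimension of the toric scheme. -/

theorem propositionn310 {I : Type u} [SemilatticeInf I] [Nonempty I]
    (𝕄 : Iᵒᵖ ⥤ AddCommMonCat.{u}) [ToricScheme.OpenlyImmersive 𝕄] [ToricScheme.Cancellable 𝕄]
    (r : ℕ) (hr : ToricScheme.systemRank 𝕄 = (r : Cardinal.{u}))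
    (S : AlgebraicGeometry.Scheme.{u}) :
    (ToricScheme.dim S + (r : WithBot ℕ∞) ≤ ToricScheme.dim (ToricScheme.toricScheme 𝕄 S) ∧
      ToricScheme.dim (ToricScheme.toricScheme 𝕄 S) ≤
        ((r : WithBot ℕ∞) + 1) * ToricScheme.dim S + (r : WithBot ℕ∞)) ∧
    (AlgebraicGeometry.IsLocallyNoetherian S →
      ToricScheme.dim (ToricScheme.toricScheme 𝕄 S) =
        ToricScheme.dim S + (r : WithBot ℕ∞)) := by
  open ToricScheme in
  have hinj (i : I) : Function.Injective (toDifferences (𝕄.obj (op i))) :=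
    have := Cancellable.isCancelAdd (𝕄 := 𝕄) i
    toDifferences_injective _
  have hrank := rank_le_of_systemRank_eq 𝕄 hr
  have hle (j : S.affineOpenCover.I₀) : ringKrullDim (S.affineOpenCover.X j) ≤ dim S := by
    rw [← dim_Spec]
    exact (S.affineOpenCover.f j).isOpenEmbedding.isInducing.topologicalKrullDim_le
  have lower : dim S + (r : WithBot ℕ∞) ≤ dim (toricScheme 𝕄 S) := by
    -- One chart of maximal rank serves for every chain in `S`; only the affine piece of `S` depends
    -- on `n`.
    obtain ⟨i, hi⟩ := exists_le_rank_of_systemRank_eq 𝕄 hr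
    refine WithBot.ENat.add_natCast_le_of_forall fun n hn ↦ ?_
    obtain ⟨j, hj⟩ := (natCast_le_dim_iff_exists S.affineOpenCover.openCover n).mp hn
    refine (natCast_le_dim_toricScheme_iff 𝕄 S _).mpr ⟨i, j, le_trans ?_
      (le_ringKrullDim_monoidAlgebra _ (exists_toDifferences_sub_eq _) hi)⟩
    rw [Nat.cast_add]
    gcongr
    exact hj.trans (dim_Spec _).le
  refine ⟨⟨lower, WithBot.ENat.le_of_forall_natCast_le fun n hn ↦ ?_⟩, fun hS ↦
    le_antisymm (WithBot.ENat.le_of_forall_natCast_le fun n hn ↦ ?_) lower⟩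
  · obtain ⟨i, j, hij⟩ := (natCast_le_dim_toricScheme_iff 𝕄 S n).mp hn
    refine (hij.trans (ringKrullDim_monoidAlgebra_le _ (hinj i) (hrank i))).trans ?_
    gcongr
    exact hle j
  · obtain ⟨i, j, hij⟩ := (natCast_le_dim_toricScheme_iff 𝕄 S n).mp hn
    have := isLocallyNoetherian_of_isOpenImmersion (S.affineOpenCover.f j)
    have : IsNoetherianRing (S.affineOpenCover.X j) := isLocallyNoetherian_Spec.mp this
    refine (hij.trans (ringKrullDim_monoidAlgebra_le_of_isNoetherianRing _ (hinj i)
      (hrank i))).trans ?_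
    gcongr
    exact hle j
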